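/- Let $S \subseteq\, ]0,+\infty[$ and let $\mathcal{U}_S$ be the class of all finite ultrametric spaces whose distances between distinct points lie in $S$. For metric spaces $X, Z$, let $\binom{Z}{X}$ be the set of subspaces of $Z$ isometric to $X$, and for integers $k, l \ge 1$ write $Z \to (Y)^X_{k,l}$ if for every map $\chi : \binom{Z}{X} \to \{1,\dots,k\}$ there is $\widetilde{Y} \in \binom{Z}{Y}$ such that $\chi$ takes at most $l$ values on $\binom{\widetilde{Y}}{X}$. The Ramsey degree of $X \in \mathcal{U}_S$ in $\mathcal{U}_S$ is, if it exists, the least integer $l \ge 1$ such that for every $Y \in \mathcal{U}_S$ and every $k \ge 1$ there is $Z \in \mathcal{U}_S$ with $Z \to (Y)^X_{k,l}$. Let $\mathrm{iso}(X)$ be the set of isometries of $X$ onto itself and $\mathrm{cLO}(X)$ the set of convex linear orderings of $X$, i.e. linear orderings for which every metric ball of $X$ is convex. Two orderings in $\mathrm{cLO}(X)$ have the same order type if some isometry of $X$ onto itself carries one to the other. Theorem. Every $X \in \mathcal{U}_S$ has a Ramsey degree in $\mathcal{U}_S$. It is equal to $|\mathrm{cLO}(X)|/|\mathrm{iso}(X)|$,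 and this is the number of order types of convex linear orderings on $X$. -/

import Mathlib

universe u

namespace UltraRamsey

/-- The class of all finite ultrametric spaces with distances in `S`: the distance between any
two distinct points belongs to `S`. -/
def FinUltrametric (S : Set ℝ) (X : Type u) (_ : MetricSpace X) : Prop :=
  Finite X ∧ IsUltrametricDist X ∧ ∀ x y : X, x ≠ y → dist x y ∈ S

/-- The set of all subspaces of `Z` which are isometric to `X` (the copies of `X` in `Z`). -/
def copies (X Z : Type u) [MetricSpace X] [MetricSpace Z] : Set (Set Z) :=
  {A | Nonempty (A ≃ᵢ X)}

/-- The arrow relation `Z ⟶ (Y)^X_{k,l}`: for every colouring `χ` of the copies of `X` in `Z` with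
`k` colours there is a copy `B` of `Y` in `Z` such that `χ` takes at most `l` values on the copies
of `X` contained in `B`. -/
def Arrows (X Y Z : Type u) [MetricSpace X] [MetricSpace Y] [MetricSpace Z] (k l : ℕ) : Prop :=
  ∀ χ : copies X Z → Fin k, ∃ B ∈ copies Y Z,
    (χ '' {A : copies X Z | (A : Set Z) ⊆ B}).ncard ≤ l

/-- `X` has a Ramsey degree in the class `K`, and it is equal to `t`: `t` is the least positive
integer `l` such that for every `Y` in `K` and every `k ≥ 1` there is `Z` in `K` with
`Z ⟶ (Y)^X_{k,l}`. -/
def IsRamseyDegree (K : (Y : Type u) → MetricSpace Y → Prop) (X : Type u) [MetricSpace X]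
    (t : ℕ) : Prop :=
  IsLeast {l : ℕ | 0 < l ∧ ∀ (Y : Type u) (_ : MetricSpace Y), K Y inferInstance →
    ∀ k : ℕ, 0 < k → ∃ (Z : Type u) (_ : MetricSpace Z), K Z inferInstance ∧ Arrows X Y Z k l} t

/-- `B` is convex for the strict ordering `r`. -/
def IsConvexFor {X : Type u} (r : X → X → Prop) (B : Set X) : Prop :=
  ∀ x ∈ B, ∀ z ∈ B, ∀ y, r x y → r y z → y ∈ B

/-- The set of convex (strict) linear orderings of `X`: all metric balls, open and closed, are
convex for the ordering. -/
def cLO (X : Type u) [MetricSpace X] : Set (X → X → Prop) :=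
  {r | IsStrictTotalOrder X r ∧ ∀ (c : X) (ε : ℝ),
    IsConvexFor r (Metric.ball c ε) ∧ IsConvexFor r (Metric.closedBall c ε)}

/-- Two convex linear orderings of `X` have the same order type when the corresponding ordered
metric spaces are isomorphic, i.e. there is an order preserving isometry between them. -/
def orderTypeSetoid (X : Type u) [MetricSpace X] : Setoid (cLO X) where
  r r₁ r₂ := ∃ e : X ≃ᵢ X, ∀ x y, r₁.1 x y ↔ r₂.1 (e x) (e y)
  iseqv :=
    { refl := fun _ => ⟨IsometryEquiv.refl X, fun _ _ => Iff.rfl⟩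
      symm := fun {_ _} ⟨e, h⟩ => ⟨e.symm, fun x y => by
        rw [h, e.apply_symm_apply, e.apply_symm_apply]⟩
      trans := fun {_ _ _} ⟨e, h⟩ ⟨f, g⟩ => ⟨e.trans f, fun x y => by
        rw [h, g]; rfl⟩ }

/-- The order types of convex linear orderings of `X`. -/
abbrev OrderTypes (X : Type u) [MetricSpace X] : Type u := Quotient (orderTypeSetoid X)

end UltraRamsey

namespace UltraRamsey

/-! Every finite ultrametric space embeds in the leaves of a regular tree, where the distance of two
leaves is the height at which they branch. A convex linear ordering of a space orders its balls, by
radius and then by position, and an increasing labelling of the balls places an ordered copy of the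
space among the leaves. Hence the copies of an ordered `X` correspond to sets of labels, the finite
Ramsey theorem makes a colouring depend only on the order type of a copy, and this bounds the Ramsey
degree from above. Conversely all convex orderings of a regular tree are isomorphic, because its
children can be permuted below each vertex, so each of them contains all orderings of `X`. Colouring
the copies of `X` by their order type then shows that the bound is attained. Finally, a finite
linear ordering is rigid, so the isometry group acts freely on the convex orderings. -/

section Ramsey

open Finset

/-- `N` witnesses the finite Ramsey theorem for `κ`-colourings of `q`-element sets and homogeneous
sets of size `m`. -/
def IsRamseyNumber (κ : Type*) (q m N : ℕ) : Prop :=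
  ∀ (α : Type u) [LinearOrder α] (A : Finset α), N ≤ #A → ∀ c : Finset α → κ,
    ∃ H ⊆ A, #H = m ∧ ∃ a, ∀ U ⊆ H, #U = q → c U = a

variable {κ : Type*}

theorem exists_color_eq_of_forall_lt {q : ℕ} (hq : ∀ m, ∃ N, IsRamseyNumber.{u} κ q m N) (j : ℕ) :
    ∃ N : ℕ, ∀ (α : Type u) [LinearOrder α] (A : Finset α), N ≤ #A → ∀ c : Finset α → κ,
      ∃ H ⊆ A, #H = j ∧ ∃ f : α → κ, ∀ x ∈ H, ∀ U ⊆ H, (∀ y ∈ U, x < y) → #U = q →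
        c (insert x U) = f x := by
  classical
  induction j with
  | zero => exact ⟨0, fun α _ A _ c => ⟨∅, empty_subset _, rfl, fun _ => c ∅, by simp⟩⟩
  | succ j ih =>
    obtain ⟨N₁, hN₁⟩ := ih
    obtain ⟨N₂, hN₂⟩ := hq N₁
    refine ⟨N₂ + 1, fun α _ A hA c => ?_⟩
    have hne : A.Nonempty := card_pos.1 (by omega)
    set a := A.min' hne
    have haA : a ∈ A := A.min'_mem hne
    obtain ⟨H₂, hH₂A, hH₂, b, hb⟩ := hN₂ α (A.erase a)
      (by rw [card_erase_of_mem haA]; omega) (fun U => c (insert a U))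
    obtain ⟨H₁, hH₁H₂, hH₁, f, hf⟩ := hN₁ α H₂ hH₂.ge c
    have a_lt : ∀ y ∈ H₁, a < y := fun y hy =>
      A.min'_lt_of_mem_erase_min' hne (hH₂A (hH₁H₂ hy))
    have haH₁ : a ∉ H₁ := fun h => lt_irrefl a (a_lt a h)
    refine ⟨insert a H₁, insert_subset haA ((hH₁H₂.trans hH₂A).trans (erase_subset _ _)),
      by rw [card_insert_of_notMem haH₁, hH₁], Function.update f a b, fun x hx U hU hxU hUq => ?_⟩
    have haU : a ∉ U := fun h => by
      rcases mem_insert.1 hx with rfl | hx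
      · exact lt_irrefl _ (hxU _ h)
      · exact lt_asymm (hxU _ h) (a_lt x hx)
    have hUH₁ : U ⊆ H₁ := (subset_insert_iff_of_notMem haU).1 hU
    rcases mem_insert.1 hx with rfl | hx
    · rw [Function.update_self, hb U (hUH₁.trans hH₁H₂) hUq]
    · rw [Function.update_of_ne (a_lt x hx).ne', hf x hx U hUH₁ hxU hUq]

theorem exists_isRamseyNumber [Finite κ] (q m : ℕ) : ∃ N, IsRamseyNumber.{u} κ q m N := by
  classical
  induction q generalizing m with
  | zero =>
    refine ⟨m, fun α _ A hA c => ?_⟩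
    obtain ⟨H, hHA, hH⟩ := exists_subset_card_eq hA
    exact ⟨H, hHA, hH, c ∅, fun U _ hU => by rw [card_eq_zero.1 hU]⟩
  | succ q ih =>
    cases nonempty_fintype κ
    obtain ⟨N, hN⟩ := exists_color_eq_of_forall_lt ih (Fintype.card κ * m)
    refine ⟨N, fun α _ A hA c => ?_⟩
    obtain ⟨H, hHA, hH, f, hf⟩ := hN α A hA c
    have : Nonempty κ := ⟨c ∅⟩
    obtain ⟨a, -, ha⟩ : ∃ a ∈ univ, m ≤ #{x ∈ H | f x = a} :=
      exists_le_card_fiber_of_mul_le_card_of_maps_to (fun _ _ => mem_univ _) univ_nonempty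
        (by rw [card_univ, hH])
    obtain ⟨K, hKa, hK⟩ := exists_subset_card_eq ha
    have hKH : K ⊆ H := hKa.trans (filter_subset _ _)
    refine ⟨K, hKH.trans hHA, hK, a, fun U hU hUq => ?_⟩
    have hne : U.Nonempty := card_pos.1 (by omega)
    have hmin := U.min'_mem hne
    calc c U = c (insert (U.min' hne) (U.erase (U.min' hne))) := by rw [insert_erase hmin]
      _ = f (U.min' hne) :=
        hf _ (hKH (hU hmin)) _ ((erase_subset _ _).trans (hU.trans hKH))
          (fun y hy => U.min'_lt_of_mem_erase_min' hne hy) (by rw [card_erase_of_mem hmin]; omega)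
      _ = a := (mem_filter.1 (hKa (hU hmin))).2

theorem exists_orderEmbedding_forall_trans_eq (κ : Type*) [Finite κ] [Nonempty κ] (q m : ℕ) :
    ∃ N : ℕ, ∀ (α : Type u) [LinearOrder α] [Fintype α], N ≤ Fintype.card α →
      ∀ c : (Fin q ↪o α) → κ, ∃ (h : Fin m ↪o α) (a : κ), ∀ g : Fin q ↪o Fin m,
        c (g.trans h) = a := by
  classical
  obtain ⟨N, hN⟩ := exists_isRamseyNumber.{u} (κ := κ) q m
  refine ⟨N, fun α _ _ hα c => ?_⟩
  obtain ⟨H, -, hH, a, ha⟩ := hN α univ hα fun U =>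
    if hU : #U = q then c (U.orderEmbOfFin hU) else Classical.arbitrary κ
  refine ⟨H.orderEmbOfFin hH, a, fun g => ?_⟩
  set gh := g.trans (H.orderEmbOfFin hH)
  have hU : #(univ.map gh.toEmbedding) = q := by simp
  have hUH : univ.map gh.toEmbedding ⊆ H := fun y hy => by
    obtain ⟨x, -, rfl⟩ := mem_map.1 hy
    exact H.orderEmbOfFin_mem hH (g x)
  have hgh : gh = (univ.map gh.toEmbedding).orderEmbOfFin hU :=
    orderEmbOfFin_unique' hU fun x => mem_map_of_mem _ (mem_univ x)
  have hcolor := ha _ hUH hU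
  rwa [dif_pos hU, ← hgh] at hcolor

end Ramsey

section ConvexOrders

open Metric

theorem isConvexFor_preimage {X Y : Type u} {r : Y → Y → Prop} {B : Set Y} (hB : IsConvexFor r B)
    (i : X → Y) : IsConvexFor (i ⁻¹'o r) (i ⁻¹' B) :=
  fun x hx z hz y => hB (i x) hx (i z) hz (i y)

variable {X Y : Type u} [MetricSpace X] [MetricSpace Y]

instance (r : cLO X) : IsStrictTotalOrder X r.1 := r.2.1

theorem dist_le_of_cLO (r : cLO X) {x y z : X} (hxy : r.1 x y) (hyz : r.1 y z) :
    dist x y ≤ dist x z ∧ dist y z ≤ dist x z := by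
  constructor
  · rw [dist_comm x y]
    exact (r.2.2 x (dist x z)).2 x (mem_closedBall_self dist_nonneg) z
      (by rw [mem_closedBall, dist_comm]) y hxy hyz
  · exact (r.2.2 z (dist x z)).2 x (by rw [mem_closedBall]) z
      (mem_closedBall_self dist_nonneg) y hxy hyz

theorem mem_cLO_of_dist_le [IsUltrametricDist X] {r : X → X → Prop} (hr : IsStrictTotalOrder X r)
    (h : ∀ x y z, r x y → r y z → dist x y ≤ dist x z) : r ∈ cLO X := by
  have dist_center (c x y z : X) (hxy : r x y) (hyz : r y z) :
      dist y c ≤ max (dist x c) (dist z c) := by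
    have hyx : dist y x ≤ max (dist x c) (dist z c) := by
      rw [dist_comm y, dist_comm z]
      exact (h x y z hxy hyz).trans (dist_triangle_max x c z)
    exact (dist_triangle_max y x c).trans (max_le hyx (le_max_left _ _))
  exact ⟨hr, fun c ε =>
    ⟨fun x hx z hz y hxy hyz => (dist_center c x y z hxy hyz).trans_lt (max_lt hx hz),
      fun x hx z hz y hxy hyz => (dist_center c x y z hxy hyz).trans (max_le hx hz)⟩⟩

theorem rel_congr_of_dist_lt [IsUltrametricDist X] (r : cLO X) {x x' y y' : X}
    (hx : dist x x' < dist x y) (hy : dist y y' < dist x y) : r.1 x y ↔ r.1 x' y' := by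
  have move {x x' y y' : X} (hx : dist x x' < dist x y) (hy : dist y y' < dist x y)
      (h : r.1 x y) : r.1 x' y' := by
    have hx'y : r.1 x' y := by
      rcases trichotomous_of r.1 x' y with h' | rfl | h'
      · exact h'
      · exact absurd hx (lt_irrefl _)
      · exact absurd hx (dist_le_of_cLO r h h').1.not_gt
    have hxx'y : dist x y ≤ dist x' y :=
      (le_max_iff.1 (dist_triangle_max x x' y)).resolve_left hx.not_ge
    have hyx'y : dist y y' < dist x' y := hy.trans_le hxx'y
    rcases trichotomous_of r.1 x' y' with h' | rfl | h'
    · exact h'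
    · rw [dist_comm] at hyx'y
      exact absurd hyx'y (lt_irrefl _)
    · rw [dist_comm y y'] at hyx'y
      exact absurd hyx'y (dist_le_of_cLO r h' hx'y).2.not_gt
  refine ⟨move hx hy, fun h' => ?_⟩
  rcases trichotomous_of r.1 x y with h | rfl | h
  · exact h
  · exact absurd hx (by rw [dist_self]; exact dist_nonneg.not_gt)
  · rw [dist_comm x y] at hx hy
    exact absurd (move hy hx h) (asymm_of r.1 h')

/-- The convex linear ordering which an isometric embedding `i : X → Y` induces on `X`. -/
def induced {i : X → Y} (hi : Isometry i) (r : cLO Y) : cLO X :=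
  ⟨i ⁻¹'o r.1, (RelEmbedding.preimage ⟨i, hi.injective⟩ r.1).isStrictTotalOrder, fun c ε => by
    rw [← hi.preimage_ball, ← hi.preimage_closedBall]
    exact ⟨isConvexFor_preimage (r.2.2 (i c) ε).1 i, isConvexFor_preimage (r.2.2 (i c) ε).2 i⟩⟩

theorem orderTypes_mk_induced (e : X ≃ᵢ X) (r : cLO X) :
    (⟦induced e.isometry r⟧ : OrderTypes X) = ⟦r⟧ :=
  Quotient.sound ⟨e, fun _ _ => Iff.rfl⟩

theorem exists_induced_eq_out (r : cLO X) :
    ∃ e : X ≃ᵢ X, induced e.isometry r = (⟦r⟧ : OrderTypes X).out := by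
  obtain ⟨e, he⟩ := Quotient.exact (Quotient.out_eq (⟦r⟧ : OrderTypes X))
  exact ⟨e, Subtype.ext (funext₂ fun x y => propext (he x y).symm)⟩

instance : MulAction (X ≃ᵢ X) (cLO X) where
  smul e r := induced e.symm.isometry r
  one_smul _ := rfl
  mul_smul _ _ _ := rfl

theorem orderTypeSetoid_eq_orbitRel :
    orderTypeSetoid X = MulAction.orbitRel (X ≃ᵢ X) (cLO X) := by
  ext r r'
  refine ⟨fun ⟨e, he⟩ => ⟨e.symm, ?_⟩, ?_⟩
  · exact Subtype.ext (funext₂ fun x y => propext (he x y).symm)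
  · rintro ⟨e, rfl⟩
    exact ⟨e.symm, fun _ _ => Iff.rfl⟩

theorem stabilizer_cLO_eq_bot [Finite X] (r : cLO X) :
    MulAction.stabilizer (X ≃ᵢ X) r = ⊥ := by
  have : IsWellFounded X r.1 := ⟨Finite.wellFounded_of_trans_of_irrefl r.1⟩
  refine (Subgroup.eq_bot_iff_forall _).2 fun e he => ?_
  have hrel : ∀ x y, r.1 (e.symm x) (e.symm y) ↔ r.1 x y := fun x y =>
    iff_of_eq (congrFun₂ (congrArg Subtype.val (MulAction.mem_stabilizer_iff.1 he)) x y)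
  let f : r.1 ≃r r.1 := ⟨e.symm.toEquiv, hrel _ _⟩
  have hf : f.toInitialSeg = InitialSeg.refl r.1 := Subsingleton.elim _ _
  have hsymm : ∀ x, e.symm x = x := fun x => congrArg (fun g : InitialSeg r.1 r.1 => g x) hf
  ext x
  exact (e.symm_apply_eq.1 (hsymm x)).symm

theorem card_cLO_eq_mul [Finite X] :
    Nat.card (cLO X) = Nat.card (OrderTypes X) * Nat.card (X ≃ᵢ X) := by
  rw [OrderTypes, orderTypeSetoid_eq_orbitRel, ← Nat.card_prod]
  exact Nat.card_congr (MulAction.selfEquivOrbitsQuotientProd stabilizer_cLO_eq_bot)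

end ConvexOrders

section Tree

theorem nonempty_relIso_of_finite {α : Type*} [Finite α] (R R' : α → α → Prop)
    [IsStrictTotalOrder α R] [IsStrictTotalOrder α R'] : Nonempty (R ≃r R') := by
  cases nonempty_fintype α
  have : IsWellOrder α R := { wf := Finite.wellFounded_of_trans_of_irrefl R }
  have : IsWellOrder α R' := { wf := Finite.wellFounded_of_trans_of_irrefl R' }
  exact Ordinal.type_eq.1 ((Ordinal.type_fintype R).trans (Ordinal.type_fintype R').symm)

theorem ball_eq_ball_iff {X : Type*} [PseudoMetricSpace X] [IsUltrametricDist X] {x y : X} {s : ℝ}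
    (hs : 0 < s) : Metric.ball x s = Metric.ball y s ↔ dist x y < s := by
  refine ⟨fun h => ?_, fun h => (IsUltrametricDist.ball_eq_of_mem h).symm⟩
  rw [← Metric.mem_ball, ← h]
  exact Metric.mem_ball_self hs

/-- The nonzero distances of `X`, as positive real numbers. -/
def distances (X : Type u) [MetricSpace X] : Set (Set.Ioi (0 : ℝ)) :=
  {s | ∃ x y : X, dist x y = s}

theorem finite_distances (X : Type u) [MetricSpace X] [Finite X] : (distances X).Finite :=
  ((Set.finite_range fun p : X × X => dist p.1 p.2).preimage Subtype.val_injective.injOn).subset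
    fun _ ⟨x, y, h⟩ => ⟨(x, y), h⟩

/-- The set `α` of children of a vertex of height `s` in a tree, with distance `s` between any two
distinct children. -/
def Branch (_ : Set.Ioi (0 : ℝ)) (α : Type u) : Type u := α

namespace Branch

variable {s : Set.Ioi (0 : ℝ)} {α : Type u}

instance [Finite α] : Finite (Branch s α) := inferInstanceAs (Finite α)

instance [LinearOrder α] : LinearOrder (Branch s α) := inferInstanceAs (LinearOrder α)

open Classical in
noncomputable instance : Dist (Branch s α) := ⟨fun a b => if a = b then 0 else s⟩

theorem dist_eq {a b : Branch s α} (h : a ≠ b) : dist a b = s := if_neg h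

theorem dist_self (a : Branch s α) : dist a a = 0 := if_pos rfl

theorem dist_le (a b : Branch s α) : dist a b ≤ s := by
  rcases eq_or_ne a b with rfl | hab
  · exact (dist_self a).trans_le s.2.le
  · exact (dist_eq hab).le

theorem dist_triangle_max (a b c : Branch s α) : dist a c ≤ max (dist a b) (dist b c) := by
  rcases eq_or_ne a b with rfl | hab
  · exact le_max_right _ _
  · exact le_max_of_le_left ((dist_le a c).trans_eq (dist_eq hab).symm)

theorem dist_nonneg (a b : Branch s α) : 0 ≤ dist a b := by
  rcases eq_or_ne a b with rfl | hab
  · exact (dist_self a).ge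
  · exact s.2.le.trans_eq (dist_eq hab).symm

noncomputable instance : MetricSpace (Branch s α) where
  dist_self := dist_self
  dist_comm a b := by
    rcases eq_or_ne a b with rfl | hab
    · rfl
    · rw [dist_eq hab, dist_eq hab.symm]
  dist_triangle a b c :=
    (dist_triangle_max a b c).trans (max_le_add_of_nonneg (dist_nonneg a b) (dist_nonneg b c))
  eq_of_dist_eq_zero {a b} h := by
    by_contra hab
    exact s.2.ne' ((dist_eq hab).symm.trans h)

instance : IsUltrametricDist (Branch s α) := ⟨dist_triangle_max⟩

end Branch

/-- The leaves of a tree in which every vertex at a height `s ∈ D` has `α` as its set of children.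
The supremum metric on these functions is the largest height at which two leaves differ. -/
abbrev Leaves (D : Finset (Set.Ioi (0 : ℝ))) (α : Type u) : Type u := (s : D) → Branch s α

namespace Leaves

variable {D : Finset (Set.Ioi (0 : ℝ))} {α : Type u} {x y : Leaves D α} {s : D}

theorem dist_lt_iff : dist x y < s ↔ ∀ t ≥ s, x t = y t := by
  refine (dist_pi_lt_iff s.1.2).trans (forall_congr' fun t => ?_)
  rcases eq_or_ne (x t) (y t) with h | h
  · simp only [h, dist_self, ge_iff_le, implies_true, iff_true]
    exact s.1.2
  · simp [h, Branch.dist_eq]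

theorem dist_eq_iff : dist x y = s ↔ x s ≠ y s ∧ ∀ t > s, x t = y t := by
  have dist_eq (hs : x s ≠ y s) (h : ∀ t > s, x t = y t) : dist x y = s := by
    refine ((dist_pi_le_iff s.1.2.le).2 fun t => ?_).antisymm
      ((Branch.dist_eq hs).symm.trans_le (dist_le_pi_dist x y s))
    rcases lt_or_ge s t with hst | hts
    · rw [h t hst, dist_self]
      exact s.1.2.le
    · exact (Branch.dist_le _ _).trans hts
  have above (h : dist x y = s) : ∀ t > s, x t = y t := fun t hst =>
    dist_lt_iff.1 (h.trans_lt hst) t le_rfl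
  refine ⟨fun h => ⟨fun hs => ?_, above h⟩, fun h => dist_eq h.1 h.2⟩
  exact h.not_lt (dist_lt_iff.2 fun t hst => hst.eq_or_lt.elim (fun h => h ▸ hs) (above h t))

theorem exists_dist_eq (h : x ≠ y) : ∃ s : D, dist x y = s := by
  obtain ⟨s, hs, hmax⟩ := Set.exists_max_image {s : D | x s ≠ y s} id (Set.toFinite _)
    (Function.ne_iff.1 h)
  exact ⟨s, dist_eq_iff.2 ⟨hs, fun t hst => by_contra fun ht => (hmax t ht).not_gt hst⟩⟩

theorem finUltrametric [Finite α] {S : Set ℝ} (hD : ∀ s ∈ D, (s : ℝ) ∈ S) :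
    FinUltrametric S (Leaves D α) inferInstance := by
  refine ⟨inferInstance, inferInstance, fun x y hxy => ?_⟩
  obtain ⟨s, hs⟩ := exists_dist_eq hxy
  exact hs ▸ hD s s.2

theorem isometry_of_forall_apply {X : Type u} [MetricSpace X] (hX : distances X ⊆ D)
    {f : X → Leaves D α} (h_eq : ∀ x y (s : D), dist x y < s → f x s = f y s)
    (h_ne : ∀ x y (s : D), dist x y = s → f x s ≠ f y s) : Isometry f := by
  refine Isometry.of_dist_eq fun x y => ?_
  rcases eq_or_ne x y with rfl | hxy
  · rw [dist_self, dist_self]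
  · let s : D := ⟨⟨dist x y, dist_pos.2 hxy⟩, hX ⟨x, y, rfl⟩⟩
    exact dist_eq_iff (s := s).2 ⟨h_ne x y s rfl, h_eq x y⟩

theorem distances_subset : distances (Leaves D α) ⊆ D := by
  rintro s ⟨x, y, h⟩
  obtain ⟨t, ht⟩ := exists_dist_eq (dist_pos.1 (s.2.trans_eq h.symm))
  exact Subtype.ext (h.symm.trans ht) ▸ t.2

theorem dist_update_update (x : Leaves D α) (s : D) {a b : Branch s α} (hab : a ≠ b) :
    dist (Function.update x s a) (Function.update x s b) = s := by
  refine dist_eq_iff.2 ⟨?_, fun t hst => ?_⟩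
  · rwa [Function.update_self, Function.update_self]
  · rw [Function.update_of_ne hst.ne', Function.update_of_ne hst.ne']

section ChildOrder

variable (r : cLO (Leaves D α)) (s : D)

/-- The ordering which `r` induces on the children of the vertex at height `s` above the leaf `y`,
read off from the leaves which differ from `y` at most at the height `s`. -/
def childOrder (y : Leaves D α) : Branch (s : Set.Ioi (0 : ℝ)) α → Branch s α → Prop :=
  fun a b => r.1 (Function.update y s a) (Function.update y s b)

instance (y : Leaves D α) : IsStrictTotalOrder (Branch s α) (childOrder r s y) :=
  (RelEmbedding.preimage ⟨Function.update y s, Function.update_injective y s⟩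
    r.1).isStrictTotalOrder

theorem childOrder_congr (h : dist x y ≤ s) : childOrder r s x = childOrder r s y := by
  have agree (t : D) (hst : t > s) : x t = y t := dist_lt_iff.1 (h.trans_lt hst) t le_rfl
  have dist_update_lt (a : Branch s α) :
      dist (Function.update x s a) (Function.update y s a) < s := by
    refine dist_lt_iff.2 fun t hst => ?_
    rcases hst.eq_or_lt with rfl | hst
    · rw [Function.update_self, Function.update_self]
    · rw [Function.update_of_ne hst.ne', Function.update_of_ne hst.ne', agree t hst]
  funext a b
  rcases eq_or_ne a b with rfl | hab
  · exact propext (iff_of_false (irrefl_of _ a) (irrefl_of _ a))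
  · have hdist := dist_update_update x s hab
    exact propext (rel_congr_of_dist_lt r ((dist_update_lt a).trans_eq hdist.symm)
      ((dist_update_lt b).trans_eq hdist.symm))

theorem childOrder_apply_iff (h : dist x y = s) : childOrder r s x (x s) (y s) ↔ r.1 x y := by
  have hy : dist (Function.update x s (y s)) y < s := dist_lt_iff.2 fun t hst => by
    rcases hst.eq_or_lt with rfl | hst
    · rw [Function.update_self]
    · rw [Function.update_of_ne hst.ne', (dist_eq_iff.1 h).2 t hst]
  have hx : Function.update x s (x s) = x := Function.update_eq_self s x
  rw [childOrder, hx]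
  rw [dist_comm] at hy
  refine (rel_congr_of_dist_lt r ?_ (hy.trans_eq h.symm)).symm
  rw [dist_self, h]
  exact s.1.2

end ChildOrder

variable [LinearOrder α]

theorem toColex_lt_iff (h : dist x y = s) : toColex x < toColex y ↔ x s < y s := by
  refine ⟨fun ⟨t, ht, hlt⟩ => ?_, fun hs => ⟨s, fun t hst => (dist_eq_iff.1 h).2 t hst, hs⟩⟩
  have hst : t = s := Subtype.ext (Subtype.ext ((dist_eq_iff.2 ⟨hlt.ne, ht⟩).symm.trans h))
  exact hst ▸ hlt

theorem dist_le_of_toColex_lt {z : Leaves D α} (hxy : toColex x < toColex y)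
    (hyz : toColex y < toColex z) : dist x y ≤ dist x z := by
  obtain ⟨s, hs⟩ := exists_dist_eq (x := x) (y := y) fun h => hxy.ne (congrArg toColex h)
  by_contra! hlt
  have hxz : ∀ t ≥ s, x t = z t := dist_lt_iff.1 (hlt.trans_eq hs)
  have hyz_dist : dist y z = s := by
    refine dist_eq_iff.2 ⟨?_, fun t hst => ?_⟩
    · rw [← hxz s le_rfl]
      exact (dist_eq_iff.1 hs).1.symm
    · rw [← hxz t hst.le, (dist_eq_iff.1 hs).2 t hst]
  exact (((toColex_lt_iff hs).1 hxy).trans ((toColex_lt_iff hyz_dist).1 hyz)).ne (hxz s le_rfl)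

/-- The colexicographic ordering of the leaves, for which two leaves compare as they do at the
largest height where they differ. -/
def colex (D : Finset (Set.Ioi (0 : ℝ))) (α : Type u) [LinearOrder α] : cLO (Leaves D α) :=
  ⟨fun x y => toColex x < toColex y,
    mem_cLO_of_dist_le
      { trichotomous := fun _ _ h h' => toColex.injective (le_antisymm (not_lt.1 h') (not_lt.1 h))
        irrefl := fun _ => lt_irrefl _
        trans := fun _ _ _ => lt_trans }
      fun _ _ _ => dist_le_of_toColex_lt⟩

theorem exists_induced_colex_eq {X : Type u} [MetricSpace X] (hX : distances X ⊆ D) (r : cLO X)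
    {f : X → Leaves D α} (h_eq : ∀ x y (s : D), dist x y < s → f x s = f y s)
    (h_lt : ∀ x y (s : D), dist x y = s → r.1 x y → f x s < f y s) :
    ∃ hf : Isometry f, induced hf (colex D α) = r := by
  have h_ne (x y : X) (s : D) (hs : dist x y = s) : f x s ≠ f y s := by
    rcases trichotomous_of r.1 x y with h | rfl | h
    · exact (h_lt x y s hs h).ne
    · exact absurd ((dist_self x).symm.trans hs) s.1.2.ne
    · exact (h_lt y x s ((dist_comm y x).trans hs) h).ne'
  have hf : Isometry f := isometry_of_forall_apply hX h_eq h_ne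
  have lt_of_rel {x y : X} (hxy : r.1 x y) : (induced hf (colex D α)).1 x y := by
    obtain ⟨s, hs⟩ := exists_dist_eq (hf.injective.ne (ne_of_irrefl hxy))
    exact (toColex_lt_iff hs).2 (h_lt x y s ((hf.dist_eq x y).symm.trans hs) hxy)
  refine ⟨hf, Subtype.ext (funext₂ fun x y => propext ⟨fun hxy => ?_, lt_of_rel⟩)⟩
  rcases trichotomous_of r.1 x y with h | rfl | h
  · exact h
  · exact absurd hxy (irrefl_of _ x)
  · exact absurd hxy (asymm_of _ (lt_of_rel h))

theorem exists_isometryEquiv_induced_colex_eq [Finite α] (r : cLO (Leaves D α)) :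
    ∃ Φ : Leaves D α ≃ᵢ Leaves D α, induced Φ.isometry (colex D α) = r := by
  let BranchOrder (s : D) := {R : Branch s α → Branch s α → Prop // IsStrictTotalOrder _ R}
  let e (s : D) (R : BranchOrder s) : R.1 ≃r ((· < ·) : Branch s α → Branch s α → Prop) :=
    have := R.2
    (nonempty_relIso_of_finite R.1 (· < ·)).some
  let child (x : Leaves D α) (s : D) : BranchOrder s :=
    ⟨childOrder r s x, inferInstance⟩
  have child_congr {x y : Leaves D α} {s : D} (h : dist x y ≤ s) : child x s = child y s :=
    Subtype.ext (childOrder_congr r s h)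
  let f : Leaves D α → Leaves D α := fun x s => e s (child x s) (x s)
  obtain ⟨hf, hfr⟩ := exists_induced_colex_eq (f := f) distances_subset r
    (fun x y s h => by
      simp only [f]
      rw [child_congr h.le, dist_lt_iff.1 h s le_rfl])
    (fun x y s h hxy => by
      simp only [f]
      rw [← child_congr h.le]
      exact (e s (child x s)).map_rel_iff.2 ((childOrder_apply_iff r s h).2 hxy))
  exact ⟨⟨Equiv.ofBijective f (Finite.injective_iff_bijective.1 hf.injective), hf⟩, hfr⟩

end Leaves

theorem cLO_nonempty (X : Type u) [MetricSpace X] [Finite X] [IsUltrametricDist X] :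
    (cLO X).Nonempty := by
  classical
  let D := (finite_distances X).toFinset
  let _ : LinearOrder (Set X) := linearOrderOfSTO WellOrderingRel
  let f : X → Leaves D (Set X) := fun x s => Metric.ball x s
  have hf : Isometry f := Leaves.isometry_of_forall_apply (finite_distances X).coe_toFinset.ge
    (fun _ _ s h => (ball_eq_ball_iff s.1.2).2 h)
    fun _ _ s h h_eq => ((ball_eq_ball_iff s.1.2).1 h_eq).ne h
  exact ⟨_, (induced hf (Leaves.colex D (Set X))).2⟩

end Tree

section Labelling

variable {X Y : Type u} [MetricSpace X] [MetricSpace Y] {D : Finset (Set.Ioi (0 : ℝ))}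
  {α β : Type*} [LinearOrder α] [LinearOrder β]

/-- `v x s` is a label for the open ball of radius `s` around `x`; the labels are ordered by the
radius and, for a fixed radius, as `r` orders the balls. -/
def IsLabelling (r : cLO X) (v : X → D → α) : Prop :=
  ∀ x y s t, v x s ≤ v y t ↔ s < t ∨ s = t ∧ (dist x y < s ∨ r.1 x y)

namespace IsLabelling

variable {r : cLO X} {v : X → D → α} {w : X → D → β}

theorem orderEmbedding_comp (hv : IsLabelling r v) (g : α ↪o β) :
    IsLabelling r fun x s => g (v x s) :=
  fun x y s t => g.le_iff_le.trans (hv x y s t)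

theorem comp_isometry (hv : IsLabelling r v) {j : Y → X} (hj : Isometry j) :
    IsLabelling (induced hj r) (v ∘ j) := fun x y s t => by
  rw [← hj.dist_eq]
  exact hv (j x) (j y) s t

theorem exists_orderEmbedding (hv : IsLabelling r v) (hsurj : Function.Surjective ↿v)
    (hw : IsLabelling r w) : ∃ g : α ↪o β, ∀ x s, g (v x s) = w x s := by
  have le_iff (x y s t) : w x s ≤ w y t ↔ v x s ≤ v y t := (hw x y s t).trans (hv x y s t).symm
  choose p hp using hsurj
  refine ⟨OrderEmbedding.ofMapLEIff (fun a => w (p a).1 (p a).2) fun a b => ?_, fun x s => ?_⟩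
  · rw [le_iff]
    exact iff_of_eq (congrArg₂ _ (hp a) (hp b))
  · exact le_antisymm ((le_iff _ _ _ _).2 (hp (v x s)).le) ((le_iff _ _ _ _).2 (hp (v x s)).ge)

theorem eq_of_dist_lt (hv : IsLabelling r v) {x y : X} {s : D} (h : dist x y < s) :
    v x s = v y s :=
  le_antisymm ((hv x y s s).2 (.inr ⟨rfl, .inl h⟩))
    ((hv y x s s).2 (.inr ⟨rfl, .inl (dist_comm x y ▸ h)⟩))

theorem lt_of_rel (hv : IsLabelling r v) {x y : X} {s : D} (hs : s ≤ dist x y) (h : r.1 x y) :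
    v x s < v y s := by
  refine lt_of_le_not_ge ((hv x y s s).2 (.inr ⟨rfl, .inr h⟩)) fun hle => ?_
  rcases (hv y x s s).1 hle with hlt | ⟨-, hlt | h'⟩
  · exact lt_irrefl s hlt
  · exact hs.not_gt (dist_comm x y ▸ hlt)
  · exact asymm_of r.1 h h'

theorem eq_iff (hv : IsLabelling r v) {x y : X} {s t : D} :
    v x s = v y t ↔ s = t ∧ dist x y < s := by
  refine ⟨fun h => ?_, fun ⟨hst, h⟩ => hst ▸ hv.eq_of_dist_lt h⟩
  have hst : s = t := by
    rcases (hv x y s t).1 h.le, (hv y x t s).1 h.ge with ⟨hst | hst, hts | hts⟩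
    · exact absurd hst hts.asymm
    · exact hts.1.symm
    · exact hst.1
    · exact hst.1
  subst hst
  refine ⟨rfl, lt_of_not_ge fun hs => ?_⟩
  rcases trichotomous_of r.1 x y with hxy | rfl | hxy
  · exact (hv.lt_of_rel hs hxy).ne h
  · exact (dist_self x ▸ hs).not_gt s.1.2
  · exact (hv.lt_of_rel (dist_comm x y ▸ hs) hxy).ne' h

theorem exists_induced_colex_eq {α : Type u} [LinearOrder α] {v : X → D → α}
    (hv : IsLabelling r v) (hX : distances X ⊆ D) :
    ∃ hf : Isometry (β := Leaves D α) v, induced hf (Leaves.colex D α) = r :=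
  Leaves.exists_induced_colex_eq hX r (fun _ _ _ => hv.eq_of_dist_lt)
    fun _ _ _ hs => hv.lt_of_rel hs.ge

end IsLabelling

theorem exists_isLabelling_lex [Finite X] [IsUltrametricDist X]
    (D : Finset (Set.Ioi (0 : ℝ))) (r : cLO X) : ∃ v : X → D → D ×ₗ ℕ, IsLabelling r v := by
  -- The points before the ball of radius `s` around `x`; counting them orders such balls.
  let pred (x : X) (s : D) : Set X := {z | r.1 z x ∧ s ≤ dist z x}
  have pred_subset {x y : X} {s : D} (h : dist x y < s) : pred x s ⊆ pred y s := by
    rintro z ⟨hzx, hsz⟩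
    have hxy : dist x y < dist z x := h.trans_le hsz
    have hle : dist z x ≤ max (dist z y) (dist y x) := dist_triangle_max z y x
    exact ⟨(rel_congr_of_dist_lt r (dist_self z ▸ dist_nonneg.trans_lt hxy) hxy).1 hzx,
      hsz.trans ((le_max_iff.1 hle).resolve_right (dist_comm x y ▸ hxy).not_ge)⟩
  have pred_ssubset {x y : X} {s : D} (hs : s ≤ dist x y) (hxy : r.1 x y) :
      pred x s ⊂ pred y s := by
    refine ⟨fun z ⟨hzx, hsz⟩ =>
      ⟨trans_of r.1 hzx hxy, hsz.trans (dist_le_of_cLO r hzx hxy).1⟩, fun h => ?_⟩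
    exact irrefl_of r.1 x (h ⟨hxy, hs⟩).1
  have ncard_le_iff (x y : X) (s : D) :
      (pred x s).ncard ≤ (pred y s).ncard ↔ dist x y < s ∨ r.1 x y := by
    refine ⟨fun hle => ?_, fun h => ?_⟩
    · by_contra! h
      rcases trichotomous_of r.1 x y with hxy | rfl | hyx
      · exact h.2 hxy
      · exact h.1.not_gt (show dist x x < s from (dist_self x).trans_lt s.1.2)
      · exact hle.not_gt (Set.ncard_lt_ncard (pred_ssubset (dist_comm x y ▸ h.1) hyx))
    · rcases lt_or_ge (dist x y) s with hs | hs
      · exact Set.ncard_le_ncard (pred_subset hs)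
      · exact Set.ncard_le_ncard (pred_ssubset hs (h.resolve_left hs.not_gt)).subset
  refine ⟨fun x s => toLex (s, (pred x s).ncard), fun x y s t => ?_⟩
  rw [Prod.Lex.toLex_le_toLex]
  refine or_congr_right (and_congr_right ?_)
  rintro rfl
  exact ncard_le_iff x y s

/-- The number of open balls of `X` with radius in `D`, where balls of different radii are counted
separately even when they have the same elements. -/
noncomputable def numBalls (X : Type u) [MetricSpace X] (D : Finset (Set.Ioi (0 : ℝ))) : ℕ :=
  Nat.card (Set.range fun p : X × D => (p.2, Metric.ball p.1 p.2))

theorem IsLabelling.card_range [IsUltrametricDist X] {r : cLO X} {v : X → D → α}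
    (hv : IsLabelling r v) : Nat.card (Set.range ↿v) = numBalls X D := by
  have hker : Setoid.ker ↿v = Setoid.ker fun p : X × D => (p.2, Metric.ball p.1 p.2) := by
    ext ⟨x, s⟩ ⟨y, t⟩
    refine hv.eq_iff.trans (Iff.trans ?_ Prod.mk_inj.symm)
    refine and_congr_right ?_
    rintro rfl
    exact (ball_eq_ball_iff s.1.2).symm
  rw [numBalls, ← Nat.card_congr (Setoid.quotientKerEquivRange _), hker]
  exact Nat.card_congr (Setoid.quotientKerEquivRange _)

theorem exists_isLabelling_surjective [Finite X] [IsUltrametricDist X]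
    (D : Finset (Set.Ioi (0 : ℝ))) (r : cLO X) :
    ∃ v : X → D → Fin (numBalls X D), IsLabelling r v ∧ Function.Surjective ↿v := by
  obtain ⟨v, hv⟩ := exists_isLabelling_lex D r
  cases nonempty_fintype (Set.range ↿v)
  let e : Fin (numBalls X D) ≃o Set.range ↿v := Fintype.orderIsoFinOfCardEq _
    (by rw [← Nat.card_eq_fintype_card, hv.card_range])
  refine ⟨fun x s => e.symm ⟨v x s, (x, s), rfl⟩,
    fun x y s t => e.symm.le_iff_le.trans (hv x y s t), fun a => ?_⟩
  obtain ⟨p, hp⟩ := (e a).2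
  exact ⟨p, e.symm_apply_eq.2 (Subtype.ext hp)⟩

end Labelling

section RamseyDegree

variable {X Y Z : Type u} [MetricSpace X] [MetricSpace Y] [MetricSpace Z]

theorem mem_copies_iff {A : Set Z} :
    A ∈ copies X Z ↔ ∃ i : X → Z, Isometry i ∧ Set.range i = A := by
  constructor
  · rintro ⟨e⟩
    refine ⟨Subtype.val ∘ e.symm, isometry_subtype_coe.comp e.symm.isometry, ?_⟩
    rw [e.symm.surjective.range_comp, Subtype.range_coe]
  · rintro ⟨i, hi, rfl⟩
    exact ⟨hi.isometryEquivOnRange.symm⟩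

theorem exists_isometry_comp_eq {i : X → Z} {f : Y → Z} (hi : Isometry i) (hf : Isometry f)
    (h : Set.range i ⊆ Set.range f) : ∃ j : X → Y, Isometry j ∧ f ∘ j = i := by
  choose j hj using fun x => h ⟨x, rfl⟩
  exact ⟨j, Isometry.of_dist_eq fun x y => by rw [← hf.dist_eq, hj, hj, hi.dist_eq], funext hj⟩

theorem exists_isometryEquiv_comp_eq {i j : X → Z} (hi : Isometry i) (hj : Isometry j)
    (h : Set.range i = Set.range j) : ∃ e : X ≃ᵢ X, j ∘ e = i := by
  obtain ⟨e, he, hje⟩ := exists_isometry_comp_eq hi hj h.le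
  obtain ⟨e', -, hie'⟩ := exists_isometry_comp_eq hj hi h.ge
  refine ⟨IsometryEquiv.mk' e e' (fun x => hj.injective ?_) he, hje⟩
  exact (congrFun hje (e' x)).trans (congrFun hie' x)

/-- The order type of the ordering which `r` induces on a copy `A` of `X`, transported to `X`. -/
noncomputable def orderType (r : cLO Z) (A : copies X Z) : OrderTypes X :=
  ⟦induced (mem_copies_iff.1 A.2).choose_spec.1 r⟧

theorem orderType_eq_mk (r : cLO Z) {A : copies X Z} {i : X → Z} (hi : Isometry i)
    (h : Set.range i = A) : orderType r A = ⟦induced hi r⟧ := by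
  obtain ⟨hj, hjA⟩ := (mem_copies_iff.1 A.2).choose_spec
  obtain ⟨e, rfl⟩ := exists_isometryEquiv_comp_eq hi hj (h.trans hjA.symm)
  exact (orderTypes_mk_induced e _).symm

theorem exists_induced_eq_out_orderType (r : cLO Z) (A : copies X Z) :
    ∃ (i : X → Z) (hi : Isometry i), Set.range i = A ∧ induced hi r = (orderType r A).out := by
  obtain ⟨i, hi, hiA⟩ := mem_copies_iff.1 A.2
  obtain ⟨e, he⟩ := exists_induced_eq_out (induced hi r)
  refine ⟨i ∘ e, hi.comp e.isometry, (e.surjective.range_comp i).trans hiA, ?_⟩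
  rw [orderType_eq_mk r hi hiA, ← he]
  rfl

theorem exists_forall_eq_comp_orderType [Finite X] [IsUltrametricDist X] [Finite Y]
    [IsUltrametricDist Y] {D : Finset (Set.Ioi (0 : ℝ))} (hX : distances X ⊆ D)
    (hY : distances Y ⊆ D) (κ : Type*) [Finite κ] [Nonempty κ] :
    ∃ (α : Type u) (_ : LinearOrder α) (_ : Finite α), ∀ χ : copies X (Leaves D α) → κ,
      ∃ B ∈ copies Y (Leaves D α), ∃ a : OrderTypes X → κ, ∀ A : copies X (Leaves D α),
        (A : Set (Leaves D α)) ⊆ B → χ A = a (orderType (Leaves.colex D α) A) := by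
  choose v hv hv_surj using exists_isLabelling_surjective (X := X) D
  obtain ⟨ρ, hρ⟩ := cLO_nonempty Y
  obtain ⟨w, hw, -⟩ := exists_isLabelling_surjective D ⟨ρ, hρ⟩
  -- A set of labels is coloured by a function of the order type: by the colours of the copies of
  -- `X` which it carries, one for each order type.
  obtain ⟨N, hN⟩ := exists_orderEmbedding_forall_trans_eq.{u} (OrderTypes X → κ) (numBalls X D)
    (numBalls Y D)
  refine ⟨ULift (Fin N), inferInstance, inferInstance, fun χ => ?_⟩
  let leaf (g : Fin (numBalls X D) ↪o ULift (Fin N)) (o : OrderTypes X) :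
      X → Leaves D (ULift (Fin N)) := fun x s => g (v o.out x s)
  have leaf_mem (g o) : Set.range (leaf g o) ∈ copies X _ :=
    have ⟨h_iso, _⟩ := ((hv o.out).orderEmbedding_comp g).exists_induced_colex_eq hX
    mem_copies_iff.2 ⟨_, h_iso, rfl⟩
  obtain ⟨h, a, ha⟩ := hN _ (by simp) fun g o => χ ⟨_, leaf_mem g o⟩
  obtain ⟨hf, hfρ⟩ := (hw.orderEmbedding_comp h).exists_induced_colex_eq hY
  refine ⟨_, mem_copies_iff.2 ⟨_, hf, rfl⟩, a, fun A hA => ?_⟩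
  set o := orderType (Leaves.colex D (ULift (Fin N))) A
  obtain ⟨i, hi, hiA, hio⟩ := exists_induced_eq_out_orderType (Leaves.colex D (ULift (Fin N))) A
  obtain ⟨j, hj, rfl⟩ := exists_isometry_comp_eq hi hf (hiA.trans_subset hA)
  have hjo : induced hj ⟨ρ, hρ⟩ = o.out := by
    rw [← hio, ← hfρ]
    rfl
  obtain ⟨g, hg⟩ := (hv o.out).exists_orderEmbedding (hv_surj _) (hjo ▸ hw.comp_isometry hj)
  have hleaf : Set.range (leaf (g.trans h) o) = A := by
    rw [← hiA]
    exact congrArg Set.range (funext₂ fun x s => congrArg h (hg x s))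
  rw [← ha g]
  exact congrArg χ (Subtype.ext hleaf.symm)

theorem FinUltrametric.coe_mem_of_mem_distances {S : Set ℝ} (hX : FinUltrametric S X inferInstance)
    {s : Set.Ioi (0 : ℝ)} (hs : s ∈ distances X) : (s : ℝ) ∈ S := by
  obtain ⟨x, y, hxy⟩ := hs
  exact hxy ▸ hX.2.2 x y (dist_pos.1 (s.2.trans_eq hxy.symm))

theorem exists_arrows {S : Set ℝ} (hX : FinUltrametric S X inferInstance)
    (hY : FinUltrametric S Y inferInstance) {k : ℕ} (hk : 0 < k) :
    ∃ (Z : Type u) (_ : MetricSpace Z), FinUltrametric S Z inferInstance ∧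
      Arrows X Y Z k (Nat.card (OrderTypes X)) := by
  classical
  have ⟨_, _, _⟩ := hX
  have ⟨_, _, _⟩ := hY
  have : NeZero k := ⟨hk.ne'⟩
  let D := (finite_distances X).toFinset ∪ (finite_distances Y).toFinset
  have hD : (D : Set (Set.Ioi (0 : ℝ))) = distances X ∪ distances Y := by simp [D]
  obtain ⟨α, _, _, hα⟩ := exists_forall_eq_comp_orderType (Set.subset_union_left.trans hD.ge)
    (Set.subset_union_right.trans hD.ge) (Fin k)
  refine ⟨Leaves D α, inferInstance, Leaves.finUltrametric fun s hs => ?_, fun χ => ?_⟩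
  · exact (hD.le hs).elim hX.coe_mem_of_mem_distances hY.coe_mem_of_mem_distances
  · obtain ⟨B, hB, a, ha⟩ := hα χ
    refine ⟨B, hB, ?_⟩
    have hsub : χ '' {A | (A : Set (Leaves D α)) ⊆ B} ⊆ Set.range a := by
      rintro _ ⟨A, hA, rfl⟩
      exact ⟨_, (ha A hA).symm⟩
    exact (Set.ncard_le_ncard hsub).trans (Finite.card_range_le a)

/-- Every convex linear ordering of `Y` contains every convex linear ordering of `X`. -/
def HasOrderingProperty (X Y : Type u) [MetricSpace X] [MetricSpace Y] : Prop :=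
  ∀ (r : cLO Y) (ρ : cLO X), ∃ (i : X → Y) (hi : Isometry i), induced hi r = ρ

theorem Leaves.hasOrderingProperty [Finite X] [IsUltrametricDist X]
    {D : Finset (Set.Ioi (0 : ℝ))} (hX : distances X ⊆ D) :
    HasOrderingProperty X (Leaves D (ULift.{u} (Fin (numBalls X D)))) := by
  intro r ρ
  obtain ⟨Φ, rfl⟩ := exists_isometryEquiv_induced_colex_eq r
  obtain ⟨v, hv, -⟩ := exists_isLabelling_surjective D ρ
  obtain ⟨hf, rfl⟩ := (hv.orderEmbedding_comp
    (ULift.orderIso.symm : Fin _ ≃o ULift.{u} (Fin _)).toOrderEmbedding).exists_induced_colex_eq hX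
  refine ⟨_, Φ.symm.isometry.comp hf, Subtype.ext (funext₂ fun x y => ?_)⟩
  exact congrArg₂ (colex D _).1 (Φ.apply_symm_apply _) (Φ.apply_symm_apply _)

theorem exists_hasOrderingProperty {S : Set ℝ} (hX : FinUltrametric S X inferInstance) :
    ∃ (Y : Type u) (_ : MetricSpace Y), FinUltrametric S Y inferInstance ∧
      HasOrderingProperty X Y := by
  have ⟨_, _, _⟩ := hX
  refine ⟨_, inferInstance, Leaves.finUltrametric fun s hs => ?_,
    Leaves.hasOrderingProperty (finite_distances X).coe_toFinset.ge⟩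
  exact hX.coe_mem_of_mem_distances ((finite_distances X).mem_toFinset.1 hs)

theorem HasOrderingProperty.card_orderTypes_le [Finite X] (hY : HasOrderingProperty X Y)
    (hZ : (cLO Z).Nonempty) {l : ℕ} (hl : Arrows X Y Z (Nat.card (OrderTypes X)) l) :
    Nat.card (OrderTypes X) ≤ l := by
  obtain ⟨r, hr⟩ := hZ
  let e := Finite.equivFin (OrderTypes X)
  let χ : copies X Z → Fin (Nat.card (OrderTypes X)) := fun A => e (orderType ⟨r, hr⟩ A)
  obtain ⟨B, hB, hBl⟩ := hl χ
  obtain ⟨j, hj, rfl⟩ := mem_copies_iff.1 hB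
  suffices χ '' {A : copies X Z | (A : Set Z) ⊆ Set.range j} = Set.univ by
    rwa [this, Set.ncard_univ, Nat.card_fin] at hBl
  refine Set.eq_univ_of_forall fun c => ?_
  obtain ⟨i, hi, hio⟩ := hY (induced hj ⟨r, hr⟩) (e.symm c).out
  refine ⟨⟨Set.range (j ∘ i), mem_copies_iff.2 ⟨_, hj.comp hi, rfl⟩⟩,
    Set.range_comp_subset_range i j, ?_⟩
  rw [← e.eq_symm_apply, orderType_eq_mk _ (hj.comp hi) rfl, ← (e.symm c).out_eq, ← hio]
  rfl

theorem isRamseyDegree_card_orderTypes {S : Set ℝ} (hX : FinUltrametric S X inferInstance) :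
    IsRamseyDegree (FinUltrametric S) X (Nat.card (OrderTypes X)) := by
  have ⟨_, _, _⟩ := hX
  have : Nonempty (OrderTypes X) := (cLO_nonempty X).to_subtype.map (Quotient.mk _)
  refine ⟨⟨Nat.card_pos, fun Y _ hY k hk => exists_arrows hX hY hk⟩, fun l ⟨_, hl⟩ => ?_⟩
  obtain ⟨Y, _, hY, hXY⟩ := exists_hasOrderingProperty hX
  obtain ⟨Z, _, ⟨_, _, _⟩, hZ⟩ := hl Y _ hY _ (Nat.card_pos (α := OrderTypes X))
  exact hXY.card_orderTypes_le (cLO_nonempty Z) hZ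

end RamseyDegree

end UltraRamsey

theorem theorem1 (S : Set ℝ) (hS : S ⊆ Set.Ioi 0) (X : Type u) [MetricSpace X]
    (hX : UltraRamsey.FinUltrametric S X inferInstance) :
    ∃ t : ℕ,
      UltraRamsey.IsRamseyDegree (UltraRamsey.FinUltrametric S) X t ∧
      (t : ℚ) = (Nat.card (UltraRamsey.cLO X) : ℚ) / (Nat.card (X ≃ᵢ X) : ℚ) ∧
      t = Nat.card (UltraRamsey.OrderTypes X) := by
  have : Finite X := hX.1
  have : Finite (X ≃ᵢ X) := Finite.of_injective _ IsometryEquiv.toEquiv_injective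
  refine ⟨_, UltraRamsey.isRamseyDegree_card_orderTypes hX, ?_, rfl⟩
  rw [eq_div_iff (Nat.cast_ne_zero.2 Nat.card_pos.ne'), UltraRamsey.card_cLO_eq_mul, Nat.cast_mul]
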